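/- Let $1\le r\le q$ be integers and let $V_{r,q}=\{X\in\mathbb{R}^{q\times r}: X^TX=I_r\}$ be the Stiefel manifold, equipped with its uniform distribution $\mu$ (the unique probability measure invariant under $X\mapsto QX$ for $Q\in O(q)$); densities are taken with respect to $\mu$. Let $A$ be a real symmetric $q\times q$ matrix with eigenvalues $0=\lambda_1\le\lambda_2\le\dots\le\lambda_q$. The balanced matrix Bingham density with parameter $A$ is $$f(X)=c_{\mathrm{MB\text{-}bal}}\,f^*(X),\qquad f^*(X)=\operatorname{etr}(-X^TAX)=\exp\{-\operatorname{tr}(X^TAX)\},\qquad c_{\mathrm{MB\text{-}bal}}=\Big(\int_{V_{r,q}} f^*\,d\mu\Big)^{-1},$$ and the matrix angular central Gaussian (ACG) density with symmetric positive definite $q\times q$ parameter $\Omega$ is $$g(X;\Omega)=|\Omega|^{r/2}\,g^*(X;\Omega),\qquad g^*(X;\Omega)=|X^T\Omega X|^{-q/2}.$$ For $b>0$ put $\Omega(b)=I_q+2A/b$ and $$M(b)=c_{\mathrm{MB\text{-}bal}}\left\{e^{-(q-b)/2}\,(q/b)^{q/2}\,|\Omega(b)|^{-1/2}\right\}^r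 .$$ Then: (i) $f$ is a probability density on $V_{r,q}$ and, for every $b>0$, $\Omega(b)$ is positive definite, $g(\cdot\,;\Omega(b))$ is a probability density on $V_{r,q}$, and for all $X\in V_{r,q}$ $$f^*(X)\le \left\{e^{-(q-b)/2}(q/b)^{q/2}\right\}^r g^*(X;\Omega(b)),\qquad f(X)\le M(b)\,g(X;\Omega(b)).$$ (ii) The equation $\sum_{i=1}^q \frac{1}{b+2\lambda_i}=1$ has exactly one solution $b_0$ in $(0,\infty)$. It satisfies $b_0\le q$, with $b_0<q$ if $A\ne 0$, and it is the unique minimizer of $M$ over $(0,\infty)$: $M(b_0)<M(b)$ for all $b>0$ with $b\ne b_0$. -/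

import Mathlib

open MeasureTheory
open scoped Matrix

noncomputable section

/-- Real matrices carry the product (equivalently, Borel) σ-algebra of their entries. -/
instance matrixMeasurableSpace {m n : ℕ} : MeasurableSpace (Matrix (Fin m) (Fin n) ℝ) :=
  inferInstanceAs (MeasurableSpace (Fin m → Fin n → ℝ))

instance matrixBorelSpace {m n : ℕ} : BorelSpace (Matrix (Fin m) (Fin n) ℝ) :=
  inferInstanceAs (BorelSpace (Fin m → Fin n → ℝ))

/-- The orthogonal group `O(q)` is compact. -/
instance orthogonalGroupCompactSpace {q : ℕ} :
    CompactSpace (Matrix.orthogonalGroup (Fin q) ℝ) := by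
  refine (isCompact_iff_compactSpace (s := (Matrix.orthogonalGroup (Fin q) ℝ :
    Set (Matrix (Fin q) (Fin q) ℝ)))).mp ?_
  have hK : IsCompact (Set.pi Set.univ fun _ : Fin q =>
      Set.pi Set.univ fun _ : Fin q => Set.Icc (-1 : ℝ) 1) :=
    isCompact_univ_pi fun _ => isCompact_univ_pi fun _ => isCompact_Icc
  refine IsCompact.of_isClosed_subset (X := Matrix (Fin q) (Fin q) ℝ) hK
    (isClosed_unitary (R := Matrix (Fin q) (Fin q) ℝ)) ?_
  intro U hU i _ j _
  have h := entry_norm_bound_of_unitary hU i j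
  rw [Real.norm_eq_abs, abs_le] at h
  exact h

/-- The Stiefel manifold `V_{r,q}` of real `q × r` matrices with orthonormal columns. -/
def stiefel (r q : ℕ) : Set (Matrix (Fin q) (Fin r) ℝ) := {X | Xᵀ * X = 1}

/-- The normalized Haar measure of the orthogonal group `O(q)`. -/
def orthogonalHaar (q : ℕ) : Measure (Matrix.orthogonalGroup (Fin q) ℝ) :=
  Measure.haarMeasure ⊤

/-- The first `r` columns of an orthogonal `q × q` matrix. -/
def firstColumns {r q : ℕ} (h : r ≤ q) (Q : Matrix.orthogonalGroup (Fin q) ℝ) : stiefel r q :=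
  ⟨(Q : Matrix (Fin q) (Fin q) ℝ).submatrix id (Fin.castLE h), by
    have hQ := (Matrix.mem_orthogonalGroup_iff' (Fin q) ℝ).mp Q.2
    change _ * _ = _
    rw [Matrix.transpose_submatrix,
      ← Matrix.submatrix_mul _ _ _ id _ Function.bijective_id, hQ]
    exact Matrix.submatrix_one _ (Fin.castLE_injective h)⟩

/-- The uniform distribution on `V_{r,q}`, i.e. the unique probability measure on it which is
invariant under left multiplication by `O(q)`: the image of the normalized Haar measure of `O(q)`
under the orbit map `Q ↦ (first r columns of Q)`. -/
def stiefelUniform {r q : ℕ} (h : r ≤ q) : Measure (stiefel r q) :=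
  (orthogonalHaar q).map (firstColumns h)

theorem continuous_firstColumns {r q : ℕ} (h : r ≤ q) : Continuous (firstColumns h) :=
  Continuous.subtype_mk (continuous_subtype_val.matrix_submatrix id (Fin.castLE h)) _

instance stiefelUniform_isProbabilityMeasure {r q : ℕ} (h : r ≤ q) :
    IsProbabilityMeasure (stiefelUniform h) := by
  have : IsProbabilityMeasure (orthogonalHaar q) :=
    ⟨by simpa [orthogonalHaar] using
      Measure.haarMeasure_self (K₀ := (⊤ : TopologicalSpace.PositiveCompacts
        (Matrix.orthogonalGroup (Fin q) ℝ)))⟩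
  exact Measure.isProbabilityMeasure_map (continuous_firstColumns h).measurable.aemeasurable

/-- `f` is a probability density with respect to `μ`. -/
def IsProbDensity {α : Type*} [MeasurableSpace α] (μ : Measure α) (f : α → ℝ) : Prop :=
  (∀ x, 0 ≤ f x) ∧ Integrable f μ ∧ ∫ x, f x ∂μ = 1

/-- The unnormalized balanced matrix Bingham density `etr(-Xᵀ A X)` on `V_{r,q}`. -/
def mbStar {r q : ℕ} (A : Matrix (Fin q) (Fin q) ℝ) (X : stiefel r q) : ℝ :=
  Real.exp (-(X.1ᵀ * A * X.1).trace)

/-- The normalizing constant of the balanced matrix Bingham density, with respect to the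
uniform distribution on `V_{r,q}`. -/
def mbConst {r q : ℕ} (h : r ≤ q) (A : Matrix (Fin q) (Fin q) ℝ) : ℝ :=
  (∫ X, mbStar A X ∂(stiefelUniform h))⁻¹

/-- The balanced matrix Bingham density. -/
def mbDensity {r q : ℕ} (h : r ≤ q) (A : Matrix (Fin q) (Fin q) ℝ) (X : stiefel r q) : ℝ :=
  mbConst h A * mbStar A X

/-- The unnormalized matrix angular central Gaussian density `|Xᵀ Ω X|^{-q/2}` on `V_{r,q}`. -/
def macgStar {r q : ℕ} (Ω : Matrix (Fin q) (Fin q) ℝ) (X : stiefel r q) : ℝ :=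
  (X.1ᵀ * Ω * X.1).det ^ (-((q : ℝ) / 2))

/-- The matrix angular central Gaussian density `|Ω|^{r/2} |Xᵀ Ω X|^{-q/2}`. -/
def macgDensity {r q : ℕ} (Ω : Matrix (Fin q) (Fin q) ℝ) (X : stiefel r q) : ℝ :=
  Ω.det ^ ((r : ℝ) / 2) * macgStar Ω X

/-- The parameter matrix `Ω(b) = I_q + 2A/b`. -/
def envelopeMatrix {q : ℕ} (A : Matrix (Fin q) (Fin q) ℝ) (b : ℝ) : Matrix (Fin q) (Fin q) ℝ :=
  1 + (2 / b) • A

/-- The bound `M(b) = c {e^{-(q-b)/2} (q/b)^{q/2} |Ω(b)|^{-1/2}}^r`, where `c` is the normalizing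
constant of the balanced matrix Bingham density. -/
def envelopeBound {r q : ℕ} (h : r ≤ q) (A : Matrix (Fin q) (Fin q) ℝ) (b : ℝ) : ℝ :=
  mbConst h A *
    (Real.exp (-((q : ℝ) - b) / 2) * ((q : ℝ) / b) ^ ((q : ℝ) / 2) *
      (envelopeMatrix A b).det ^ (-(1 / 2 : ℝ))) ^ r

end

/-! The envelope is a scalar inequality in disguise. Since `XᵀΩ(b)X = 1 + (2/b) XᵀAX`, both sides
factor over the eigenvalues of `XᵀAX`, and each factor reduces to `log t ≤ t - 1`
(`exp_neg_le_rpow`). Up to constants and a positive power, `M(b)` is the exponential of `(b - ∑ log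
(b + 2λᵢ))/2`. The strict tangent inequality for `log` at a root of the secular equation makes that
root the only minimizer (`sub_sum_log_lt`).

The hard part is the mass of the angular central Gaussian (`lintegral_macgStar`). With `P² = Ω`, the
weight `etr(-(PQZ)ᵀ(PQZ))` is integrated over `Q ∈ O(q)` and all `q × r` matrices `Z` in both
orders. Integrating `Z` first gives the Jacobian `|Ω|^(-r/2)`. Averaging over `Q` first replaces
`PQZ` by `ZR`, where `R² = XᵀΩX` and `X` is the first `r` columns of `Q`; the `Z`-integral then
gives `|XᵀΩX|^(-q/2)`. -/

instance matrixSecondCountable {m n : ℕ} :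
    SecondCountableTopology (Matrix (Fin m) (Fin n) ℝ) :=
  inferInstanceAs (SecondCountableTopology (Fin m → Fin n → ℝ))

instance orthogonalHaar_isHaarMeasure {q : ℕ} : (orthogonalHaar q).IsHaarMeasure := by
  unfold orthogonalHaar; infer_instance

instance orthogonalHaar_isProbabilityMeasure {q : ℕ} :
    IsProbabilityMeasure (orthogonalHaar q) :=
  ⟨by simpa [orthogonalHaar] using
    Measure.haarMeasure_self (K₀ := (⊤ : TopologicalSpace.PositiveCompacts
      (Matrix.orthogonalGroup (Fin q) ℝ)))⟩

/-- A right translate is again a left Haar probability measure, and such a measure is unique. -/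
instance orthogonalHaar_isMulRightInvariant {q : ℕ} : (orthogonalHaar q).IsMulRightInvariant where
  map_mul_right_eq_self g := by
    have : IsProbabilityMeasure ((orthogonalHaar q).map (· * g)) :=
      Measure.isProbabilityMeasure_map (continuous_mul_const g).measurable.aemeasurable
    exact Measure.isHaarMeasure_eq_of_isProbabilityMeasure _ _

/-! ### Jacobians of matrix multiplication. -/

theorem lintegral_comp_linearMap {q r : ℕ} (f : (Fin q → Fin r → ℝ) →ₗ[ℝ] (Fin q → Fin r → ℝ))
    (hf : LinearMap.det f ≠ 0) {F : (Fin q → Fin r → ℝ) → ENNReal} (hF : Measurable F) :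
    ∫⁻ z, F (f z) = ENNReal.ofReal |(LinearMap.det f)⁻¹| * ∫⁻ z, F z := by
  have hm : Measurable f := (LinearMap.continuous_of_finiteDimensional f).measurable
  rw [← lintegral_map hF hm, Measure.map_linearMap_addHaar_eq_smul_addHaar volume hf,
    lintegral_smul_measure, smul_eq_mul]

/-- The map acts on each of the `q` rows separately, as `Rᵀ`. -/
theorem det_mulRightLinearMap {q r : ℕ} (R : Matrix (Fin r) (Fin r) ℝ) :
    LinearMap.det (mulRightLinearMap (Fin q) ℝ R) = R.det ^ q := by
  have h := LinearMap.det_pi (R := ℝ) (M := Fin r → ℝ) (fun _ : Fin q => Matrix.toLin' Rᵀ)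
  rw [LinearMap.det_toLin', Matrix.det_transpose, Finset.prod_const, Finset.card_univ,
    Fintype.card_fin] at h
  rw [← h]
  congr 1
  refine LinearMap.ext fun X => funext fun i => funext fun j => ?_
  change (X * R) i j = (Rᵀ *ᵥ X i) j
  simp [Matrix.mul_apply, Matrix.mulVec, dotProduct, mul_comm]

/-- Transposition conjugates it to right multiplication by `Pᵀ`. -/
theorem det_mulLeftLinearMap {q r : ℕ} (P : Matrix (Fin q) (Fin q) ℝ) :
    LinearMap.det (mulLeftLinearMap (Fin r) ℝ P) = P.det ^ r := by
  rw [← Matrix.det_transpose P, ← det_mulRightLinearMap,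
    ← LinearMap.det_conj _ (Matrix.transposeLinearEquiv (Fin q) (Fin r) ℝ ℝ)]
  congr 1
  refine LinearMap.ext fun X => ?_
  simp [Matrix.transpose_mul]

/-! ### Gram matrices and square roots. -/

theorem LinearIsometry.exists_orthogonal_matrix {q : ℕ}
    (u : EuclideanSpace ℝ (Fin q) →ₗᵢ[ℝ] EuclideanSpace ℝ (Fin q)) :
    ∃ U : Matrix.orthogonalGroup (Fin q) ℝ,
      ∀ x, Matrix.toEuclideanLin (U : Matrix (Fin q) (Fin q) ℝ) x = u x := by
  obtain ⟨U, hU⟩ := (Matrix.toEuclideanLin (𝕜 := ℝ)).surjective u.toLinearMap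
  have hU' : ∀ x, Matrix.toEuclideanLin U x = u x := fun x => by rw [hU]; rfl
  refine ⟨⟨U, (Matrix.mem_orthogonalGroup_iff' (Fin q) ℝ).mpr ?_⟩, hU'⟩
  have h1 : ∀ i k, U k i = u (EuclideanSpace.single i 1) k := fun i k => by
    rw [← hU']; simp
  ext i j
  calc (Uᵀ * U) i j
      = ∑ k, u (EuclideanSpace.single i 1) k * u (EuclideanSpace.single j 1) k := by
        simp only [Matrix.mul_apply, Matrix.transpose_apply, h1]
    _ = inner ℝ (u (EuclideanSpace.single i 1)) (u (EuclideanSpace.single j 1)) := by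
        rw [PiLp.inner_apply]
        exact Finset.sum_congr rfl fun k _ => mul_comm _ _
    _ = (1 : Matrix (Fin q) (Fin q) ℝ) i j := by
        rw [u.inner_map_map, EuclideanSpace.inner_single_left]
        simp [Matrix.one_apply]

/-- Two real matrices with the same Gram matrix differ by an orthogonal factor. -/
theorem exists_orthogonal_mul_eq {q r : ℕ} {M N : Matrix (Fin q) (Fin r) ℝ}
    (h : Mᵀ * M = Nᵀ * N) :
    ∃ U : Matrix.orthogonalGroup (Fin q) ℝ, M = (U : Matrix (Fin q) (Fin q) ℝ) * N := by
  let m := Matrix.toEuclideanLin (𝕜 := ℝ) M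
  let n := Matrix.toEuclideanLin (𝕜 := ℝ) N
  have key : ∀ (B : Matrix (Fin q) (Fin r) ℝ) (v : EuclideanSpace ℝ (Fin r)),
      ‖Matrix.toEuclideanLin (𝕜 := ℝ) B v‖ ^ 2 = v.ofLp ⬝ᵥ ((Bᵀ * B) *ᵥ v.ofLp) := by
    intro B v
    rw [EuclideanSpace.real_norm_sq_eq, ← Matrix.mulVec_mulVec, Matrix.dotProduct_mulVec,
      Matrix.vecMul_transpose]
    simp [dotProduct, sq]
  have hnorm : ∀ v, ‖m v‖ = ‖n v‖ := fun v => by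
    rw [← sq_eq_sq₀ (norm_nonneg _) (norm_nonneg _), key, key, h]
  obtain ⟨s, hs⟩ := n.rangeRestrict.exists_rightInverse_of_surjective n.range_rangeRestrict
  have hs' : ∀ y, n (s y) = y := fun y => congrArg Subtype.val (LinearMap.congr_fun hs y)
  let L : LinearMap.range n →ₗᵢ[ℝ] EuclideanSpace ℝ (Fin q) :=
    ⟨m ∘ₗ s, fun y => by
      rw [LinearMap.comp_apply, hnorm, hs']; rfl⟩
  have hL : ∀ v, L (n.rangeRestrict v) = m v := by
    intro v
    change m (s (n.rangeRestrict v)) = m v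
    -- The section `s` is arbitrary, but equal norms give `m` and `n` the same kernel, so `m` does
    -- not see the choice.
    rw [← sub_eq_zero, ← map_sub, ← norm_eq_zero, hnorm, map_sub, hs']
    simp
  obtain ⟨U, hU⟩ := L.extend.exists_orthogonal_matrix
  refine ⟨U, (Matrix.toEuclideanLin (𝕜 := ℝ)).injective (LinearMap.ext fun v => ?_)⟩
  have h3 : L.extend (n v) = m v := by
    rw [← hL]; exact L.extend_apply (n.rangeRestrict v)
  rw [← hU] at h3
  change m v = _
  rw [← h3]
  simp [n, Matrix.toLpLin_apply, Matrix.mulVec_mulVec]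

open scoped MatrixOrder in
theorem Matrix.PosSemidef.exists_transpose_mul_self {n : ℕ} {W : Matrix (Fin n) (Fin n) ℝ}
    (hW : W.PosSemidef) : ∃ R : Matrix (Fin n) (Fin n) ℝ, Rᵀ = R ∧ R * R = W := by
  refine ⟨CFC.sqrt W, ?_, CFC.sqrt_mul_sqrt_self W hW.nonneg⟩
  have := (Matrix.nonneg_iff_posSemidef.mp (CFC.sqrt_nonneg W)).isHermitian
  simpa [Matrix.IsHermitian, Matrix.conjTranspose_eq_transpose_of_trivial] using this

/-! ### Gaussian integrals over matrices. -/

/-- Lebesgue measure on the space of `q × r` matrices. -/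
noncomputable def matrixVolume (q r : ℕ) : Measure (Matrix (Fin q) (Fin r) ℝ) :=
  (volume : Measure (Fin q → Fin r → ℝ))

instance {q r : ℕ} : SFinite (matrixVolume q r) :=
  inferInstanceAs (SFinite (volume : Measure (Fin q → Fin r → ℝ)))

theorem lintegral_matrixVolume_comp {q r : ℕ}
    (f : Matrix (Fin q) (Fin r) ℝ →ₗ[ℝ] Matrix (Fin q) (Fin r) ℝ)
    (hf : LinearMap.det f ≠ 0) {F : Matrix (Fin q) (Fin r) ℝ → ENNReal} (hF : Measurable F) :
    ∫⁻ Z, F (f Z) ∂(matrixVolume q r) =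
      ENNReal.ofReal |(LinearMap.det f)⁻¹| * ∫⁻ Z, F Z ∂(matrixVolume q r) :=
  lintegral_comp_linearMap (q := q) (r := r) f hf hF

/-- The standard Gaussian weight `etr(-ZᵀZ)` on `q × r` matrices. -/
noncomputable def gaussWeight {q r : ℕ} (Z : Matrix (Fin q) (Fin r) ℝ) : ENNReal :=
  ENNReal.ofReal (Real.exp (-(Zᵀ * Z).trace))

theorem continuous_gaussWeight {q r : ℕ} :
    Continuous (gaussWeight : Matrix (Fin q) (Fin r) ℝ → ENNReal) := by
  unfold gaussWeight
  exact ENNReal.continuous_ofReal.comp (by fun_prop)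

/-- The total mass of the standard Gaussian weight. -/
noncomputable def gaussMass (q r : ℕ) : ENNReal :=
  ∫⁻ Z, gaussWeight Z ∂(matrixVolume q r)

theorem gaussWeight_eq_prod {q r : ℕ} (Z : Matrix (Fin q) (Fin r) ℝ) :
    gaussWeight Z = ENNReal.ofReal (∏ i, ∏ j, Real.exp (-1 * Z i j ^ 2)) := by
  unfold gaussWeight
  simp_rw [← Real.exp_sum]
  congr 2
  simp only [Matrix.trace, Matrix.diag, Matrix.mul_apply, Matrix.transpose_apply, neg_one_mul,
    Finset.sum_neg_distrib, sq]
  rw [Finset.sum_comm]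

theorem gaussMass_ne_zero (q r : ℕ) : gaussMass q r ≠ 0 := by
  have h : Measurable (gaussWeight : Matrix (Fin q) (Fin r) ℝ → ENNReal) :=
    continuous_gaussWeight.measurable
  refine ((lintegral_pos_iff_support h).mpr ?_).ne'
  have : Function.support (gaussWeight : Matrix (Fin q) (Fin r) ℝ → ENNReal) = Set.univ := by
    ext Z
    simp [gaussWeight, Real.exp_pos]
  rw [this]
  exact isOpen_univ.measure_pos (volume : Measure (Fin q → Fin r → ℝ)) Set.univ_nonempty

theorem gaussMass_ne_top (q r : ℕ) : gaussMass q r ≠ ⊤ := by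
  have h1 : Integrable (fun x : ℝ => Real.exp (-1 * x ^ 2)) :=
    integrable_exp_neg_mul_sq one_pos
  have h2 : Integrable (fun z : Fin r → ℝ => ∏ j, Real.exp (-1 * z j ^ 2)) :=
    Integrable.fintype_prod (fun _ => h1)
  have h3 : Integrable (fun Z : Fin q → Fin r → ℝ => ∏ i, ∏ j, Real.exp (-1 * Z i j ^ 2)) :=
    Integrable.fintype_prod (f := fun _ (z : Fin r → ℝ) => ∏ j, Real.exp (-1 * z j ^ 2))
      (fun _ => h2)
  unfold gaussMass
  simp_rw [gaussWeight_eq_prod]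
  exact h3.lintegral_lt_top.ne

theorem lintegral_gaussWeight_mul_left {q r : ℕ} {P : Matrix (Fin q) (Fin q) ℝ} (hP : P.det ≠ 0) :
    ∫⁻ Z, gaussWeight (P * Z) ∂(matrixVolume q r) =
      ENNReal.ofReal (|P.det|⁻¹ ^ r) * gaussMass q r := by
  have := lintegral_matrixVolume_comp (mulLeftLinearMap (Fin r) ℝ P)
    (by rw [det_mulLeftLinearMap]; exact pow_ne_zero _ hP)
    continuous_gaussWeight.measurable
  rw [det_mulLeftLinearMap, abs_inv, abs_pow, ← inv_pow] at this
  exact this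

theorem lintegral_gaussWeight_mul_right {q r : ℕ} {R : Matrix (Fin r) (Fin r) ℝ}
    (hR : R.det ≠ 0) :
    ∫⁻ Z, gaussWeight (Z * R) ∂(matrixVolume q r) =
      ENNReal.ofReal (|R.det|⁻¹ ^ q) * gaussMass q r := by
  have := lintegral_matrixVolume_comp (mulRightLinearMap (Fin q) ℝ R)
    (by rw [det_mulRightLinearMap]; exact pow_ne_zero _ hR)
    continuous_gaussWeight.measurable
  rw [det_mulRightLinearMap, abs_inv, abs_pow, ← inv_pow] at this
  exact this

theorem det_orthogonal_abs {q : ℕ} (Q : Matrix.orthogonalGroup (Fin q) ℝ) :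
    |(Q : Matrix (Fin q) (Fin q) ℝ).det| = 1 := by
  have h := congrArg Matrix.det ((Matrix.mem_orthogonalGroup_iff' (Fin q) ℝ).mp Q.2)
  rw [Matrix.det_mul, Matrix.det_transpose, Matrix.det_one, ← sq] at h
  exact (pow_eq_one_iff_of_nonneg (abs_nonneg _) two_ne_zero).mp (by rw [sq_abs, h])

theorem coe_firstColumns {r q : ℕ} (h : r ≤ q) (Q : Matrix.orthogonalGroup (Fin q) ℝ) :
    (firstColumns h Q).1 = (Q : Matrix (Fin q) (Fin q) ℝ) * (firstColumns h 1).1 := by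
  simp only [firstColumns]
  rw [show (((1 : Matrix.orthogonalGroup (Fin q) ℝ) : Matrix (Fin q) (Fin q) ℝ)) = 1 from rfl]
  ext i j
  simp [Matrix.mul_apply, Matrix.one_apply]

/-- Averaging over `O(q)` lets one replace a `q × r` matrix by its polar factor. -/
theorem lintegral_gaussWeight_orthogonal {r q : ℕ} (h : r ≤ q) {P : Matrix (Fin q) (Fin q) ℝ}
    (Z : Matrix (Fin q) (Fin r) ℝ) (R : Matrix.orthogonalGroup (Fin q) ℝ → Matrix (Fin r) (Fin r) ℝ)
    (hRs : ∀ Q, (R Q)ᵀ = R Q)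
    (hR : ∀ Q, R Q * R Q = (firstColumns h Q).1ᵀ * (Pᵀ * P) * (firstColumns h Q).1) :
    ∫⁻ Q, gaussWeight (P * (Q : Matrix (Fin q) (Fin q) ℝ) * Z) ∂(orthogonalHaar q) =
      ∫⁻ Q, gaussWeight (Z * R Q) ∂(orthogonalHaar q) := by
  have hps : (Zᵀ * Z).PosSemidef := by
    simpa using Matrix.posSemidef_conjTranspose_mul_self Z
  obtain ⟨T, hTs, hT⟩ := hps.exists_transpose_mul_self
  set E := (firstColumns h 1).1 with hE
  have hEE : Eᵀ * E = 1 := (firstColumns h 1).2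
  have hgram : Zᵀ * Z = (E * T)ᵀ * (E * T) := by
    rw [Matrix.transpose_mul, Matrix.mul_assoc, ← Matrix.mul_assoc Eᵀ, hEE, Matrix.one_mul, hTs, hT]
  obtain ⟨U, hU⟩ := exists_orthogonal_mul_eq hgram
  -- Here `Z = U E T` is a polar form; right invariance absorbs `U` into `Q`.
  rw [← lintegral_mul_right_eq_self (fun Q => gaussWeight (Z * R Q)) U]
  refine lintegral_congr fun Q => ?_
  unfold gaussWeight
  congr 3
  have hX : P * (Q : Matrix (Fin q) (Fin q) ℝ) * Z = P * ((firstColumns h (Q * U)).1 * T) := by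
    rw [coe_firstColumns, ← hE, hU]
    simp only [Submonoid.coe_mul, Matrix.mul_assoc]
  set X := (firstColumns h (Q * U)).1 with hXdef
  calc ((P * (Q : Matrix (Fin q) (Fin q) ℝ) * Z)ᵀ * (P * (Q : Matrix (Fin q) (Fin q) ℝ) * Z)).trace
      = (T * (Xᵀ * (Pᵀ * P) * X) * T).trace := by
        rw [hX]
        simp only [Matrix.transpose_mul, Matrix.mul_assoc, hTs]
    -- Cyclicity of the trace exchanges the roles of the square roots `T` and `R`.
    _ = (R (Q * U) * (T * T) * R (Q * U)).trace := by
        rw [← hR, Matrix.trace_mul_comm, Matrix.trace_mul_comm (R (Q * U) * (T * T)),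
          ← Matrix.mul_assoc, ← Matrix.mul_assoc (R (Q * U)), Matrix.trace_mul_comm]
    _ = _ := by
        rw [hT]
        simp only [Matrix.transpose_mul, Matrix.mul_assoc, hRs]

/-! ### Total mass of the angular central Gaussian. -/

theorem injective_mulVec_of_mem_stiefel {r q : ℕ} (X : stiefel r q) :
    Function.Injective X.1.mulVec := by
  intro v w hvw
  have := congrArg (X.1ᵀ *ᵥ ·) hvw
  simpa [Matrix.mulVec_mulVec, show X.1ᵀ * X.1 = 1 from X.2] using this

theorem Matrix.PosDef.stiefel_compress {r q : ℕ} {Ω : Matrix (Fin q) (Fin q) ℝ} (hΩ : Ω.PosDef)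
    (X : stiefel r q) : (X.1ᵀ * Ω * X.1).PosDef := by
  simpa using hΩ.conjTranspose_mul_mul_same (injective_mulVec_of_mem_stiefel X)

theorem inv_abs_det_pow_eq {n : ℕ} {R W : Matrix (Fin n) (Fin n) ℝ} (hR : R * R = W)
    (k : ℕ) (hW : W.PosDef) :
    R.det ≠ 0 ∧ |R.det|⁻¹ ^ k = W.det ^ (-((k : ℝ) / 2)) := by
  have hd : |R.det| ^ 2 = W.det := by rw [sq_abs, ← hR, Matrix.det_mul, sq]
  have hpos := hW.det_pos
  have h0 : R.det ≠ 0 := by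
    intro h0
    rw [← hd, h0] at hpos
    simp at hpos
  refine ⟨h0, ?_⟩
  have hp : 0 < |R.det| := abs_pos.mpr h0
  rw [← hd, ← Real.rpow_natCast |R.det| 2, ← Real.rpow_mul hp.le, ← Real.rpow_natCast,
    ← Real.rpow_neg_one, ← Real.rpow_mul hp.le]
  congr 1
  push_cast
  ring

/-- The root `R` is merely chosen pointwise, but the weight depends on it only through `R * R`,
which is continuous in `Q`. This supplies the measurability for Tonelli. -/
theorem continuous_gaussWeight_mul_sqrt {r q : ℕ} (h : r ≤ q) {Ω : Matrix (Fin q) (Fin q) ℝ}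
    (R : Matrix.orthogonalGroup (Fin q) ℝ → Matrix (Fin r) (Fin r) ℝ) (hRs : ∀ Q, (R Q)ᵀ = R Q)
    (hR : ∀ Q, R Q * R Q = (firstColumns h Q).1ᵀ * Ω * (firstColumns h Q).1) :
    Continuous (Function.uncurry fun (Q : Matrix.orthogonalGroup (Fin q) ℝ)
      (Z : Matrix (Fin q) (Fin r) ℝ) => gaussWeight (Z * R Q)) := by
  have he : (Function.uncurry fun (Q : Matrix.orthogonalGroup (Fin q) ℝ)
      (Z : Matrix (Fin q) (Fin r) ℝ) => gaussWeight (Z * R Q)) =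
      fun p => ENNReal.ofReal (Real.exp (-(p.2 * ((firstColumns h p.1).1ᵀ * Ω *
        (firstColumns h p.1).1) * p.2ᵀ).trace)) := by
    funext p
    simp only [Function.uncurry, gaussWeight]
    rw [← hR, Matrix.trace_mul_comm, Matrix.transpose_mul, hRs]
    simp only [Matrix.mul_assoc]
  rw [he]
  have h1 : Continuous fun p : Matrix.orthogonalGroup (Fin q) ℝ × Matrix (Fin q) (Fin r) ℝ =>
      (firstColumns h p.1).1 :=
    continuous_subtype_val.comp ((continuous_firstColumns h).comp continuous_fst)
  exact ENNReal.continuous_ofReal.comp (by fun_prop)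

theorem lintegral_macgStar {r q : ℕ} (h : r ≤ q) {Ω : Matrix (Fin q) (Fin q) ℝ}
    (hΩ : Ω.PosDef) :
    ∫⁻ Q, ENNReal.ofReal (macgStar Ω (firstColumns h Q)) ∂(orthogonalHaar q) =
      ENNReal.ofReal (Ω.det ^ (-((r : ℝ) / 2))) := by
  obtain ⟨P, hPs, hP⟩ := hΩ.posSemidef.exists_transpose_mul_self
  obtain ⟨hP0, hPd⟩ := inv_abs_det_pow_eq hP r hΩ
  have hW := fun Q => hΩ.stiefel_compress (firstColumns h Q)
  choose R hRs hR using fun Q => (hW Q).posSemidef.exists_transpose_mul_self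
  have hRd := fun Q => inv_abs_det_pow_eq (hR Q) q (hW Q)
  -- Both orders of integration produce the factor `gaussMass q r`, so it is inserted here and never
  -- evaluated.
  refine (ENNReal.mul_left_inj (gaussMass_ne_zero q r) (gaussMass_ne_top q r)).mp ?_
  rw [← lintegral_mul_const' _ _ (gaussMass_ne_top q r)]
  calc ∫⁻ Q, ENNReal.ofReal (macgStar Ω (firstColumns h Q)) * gaussMass q r ∂(orthogonalHaar q)
      = ∫⁻ Q, ∫⁻ Z, gaussWeight (Z * R Q) ∂(matrixVolume q r) ∂(orthogonalHaar q) := by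
        refine lintegral_congr fun Q => ?_
        rw [lintegral_gaussWeight_mul_right (hRd Q).1, (hRd Q).2]
        rfl
    _ = ∫⁻ Z, ∫⁻ Q, gaussWeight (Z * R Q) ∂(orthogonalHaar q) ∂(matrixVolume q r) :=
        lintegral_lintegral_swap (continuous_gaussWeight_mul_sqrt h R hRs hR).aemeasurable
    _ = ∫⁻ Z, ∫⁻ Q, gaussWeight (P * (Q : Matrix (Fin q) (Fin q) ℝ) * Z)
          ∂(orthogonalHaar q) ∂(matrixVolume q r) := by
        refine lintegral_congr fun Z => ?_
        refine (lintegral_gaussWeight_orthogonal h (P := P) Z R hRs fun Q => ?_).symm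
        rw [hR, hPs, hP]
    _ = ∫⁻ Q : Matrix.orthogonalGroup (Fin q) ℝ, ∫⁻ Z,
          gaussWeight (P * (Q : Matrix (Fin q) (Fin q) ℝ) * Z)
          ∂(matrixVolume q r) ∂(orthogonalHaar q) := by
        refine lintegral_lintegral_swap (Continuous.aemeasurable ?_)
        refine continuous_gaussWeight.comp ?_
        exact (continuous_const.matrix_mul
          (continuous_subtype_val.comp continuous_snd)).matrix_mul continuous_fst
    _ = ∫⁻ Q : Matrix.orthogonalGroup (Fin q) ℝ,
          ENNReal.ofReal (Ω.det ^ (-((r : ℝ) / 2))) * gaussMass q r ∂(orthogonalHaar q) := by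
        refine lintegral_congr fun Q => ?_
        have hQ := det_orthogonal_abs Q
        have hQ0 : (Q : Matrix (Fin q) (Fin q) ℝ).det ≠ 0 := fun h0 => by simp [h0] at hQ
        rw [lintegral_gaussWeight_mul_left (by rw [Matrix.det_mul]; exact mul_ne_zero hP0 hQ0),
          Matrix.det_mul, abs_mul, hQ, mul_one, hPd]
    _ = ENNReal.ofReal (Ω.det ^ (-((r : ℝ) / 2))) * gaussMass q r := by
        simp

theorem Matrix.IsHermitian.det_one_add_smul {n : ℕ} {B : Matrix (Fin n) (Fin n) ℝ}
    (hB : B.IsHermitian) (c : ℝ) : (1 + c • B).det = ∏ i, (1 + c * hB.eigenvalues i) := by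
  set U : Matrix (Fin n) (Fin n) ℝ := hB.eigenvectorUnitary.1
  have hUU : U * star U = 1 := Unitary.coe_mul_star_self hB.eigenvectorUnitary
  have hs : B = U * Matrix.diagonal hB.eigenvalues * star U := by
    have h := hB.spectral_theorem
    rw [Unitary.conjStarAlgAut_apply] at h
    exact h
  have h1 : 1 + c • B = U * Matrix.diagonal (fun i => 1 + c * hB.eigenvalues i) * star U := by
    have hd : Matrix.diagonal (fun i => 1 + c * hB.eigenvalues i) =
        1 + c • Matrix.diagonal hB.eigenvalues := by
      rw [← Matrix.diagonal_one, ← Matrix.diagonal_smul, Matrix.diagonal_add]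
      rfl
    rw [hd, Matrix.mul_add, Matrix.add_mul, Matrix.mul_one, hUU, Matrix.mul_smul,
      Matrix.smul_mul, ← hs]
  rw [h1, Matrix.det_mul, Matrix.det_mul, mul_right_comm, ← Matrix.det_mul, hUU, Matrix.det_one,
    one_mul, Matrix.det_diagonal]

/-! ### The two probability densities. -/

theorem integrable_stiefelUniform_of_continuous {r q : ℕ} (h : r ≤ q) {f : stiefel r q → ℝ}
    (hf : Continuous f) : Integrable f (stiefelUniform h) :=
  (integrable_map_measure hf.aestronglyMeasurable
    (continuous_firstColumns h).measurable.aemeasurable).mpr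
    ((hf.comp (continuous_firstColumns h)).integrable_of_hasCompactSupport
      (HasCompactSupport.of_compactSpace _))

theorem continuous_mbStar {r q : ℕ} (A : Matrix (Fin q) (Fin q) ℝ) :
    Continuous (mbStar A : stiefel r q → ℝ) := by
  unfold mbStar
  fun_prop

theorem mbConst_pos {r q : ℕ} (h : r ≤ q) (A : Matrix (Fin q) (Fin q) ℝ) : 0 < mbConst h A :=
  inv_pos.mpr (integral_exp_pos (integrable_stiefelUniform_of_continuous h (continuous_mbStar A)))

theorem isProbDensity_mbDensity {r q : ℕ} (h : r ≤ q) (A : Matrix (Fin q) (Fin q) ℝ) :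
    IsProbDensity (stiefelUniform h) (mbDensity h A) := by
  refine ⟨fun X => mul_nonneg (mbConst_pos h A).le (Real.exp_nonneg _),
    (integrable_stiefelUniform_of_continuous h (continuous_mbStar A)).const_mul _, ?_⟩
  unfold mbDensity
  rw [integral_const_mul]
  exact inv_mul_cancel₀ (inv_pos.mp (mbConst_pos h A)).ne'

theorem continuous_macgStar {r q : ℕ} {Ω : Matrix (Fin q) (Fin q) ℝ} (hΩ : Ω.PosDef) :
    Continuous (macgStar Ω : stiefel r q → ℝ) := by
  unfold macgStar
  refine Continuous.rpow_const (by fun_prop) fun X => Or.inl (hΩ.stiefel_compress X).det_pos.ne'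

theorem macgStar_nonneg {r q : ℕ} {Ω : Matrix (Fin q) (Fin q) ℝ} (hΩ : Ω.PosDef)
    (X : stiefel r q) : 0 ≤ macgStar Ω X :=
  Real.rpow_nonneg (hΩ.stiefel_compress X).det_pos.le _

theorem isProbDensity_macgDensity {r q : ℕ} (h : r ≤ q) {Ω : Matrix (Fin q) (Fin q) ℝ}
    (hΩ : Ω.PosDef) : IsProbDensity (stiefelUniform h) (macgDensity Ω) := by
  have hd := hΩ.det_pos
  refine ⟨fun X => mul_nonneg (Real.rpow_nonneg hd.le _) (macgStar_nonneg hΩ X),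
    (integrable_stiefelUniform_of_continuous h (continuous_macgStar hΩ)).const_mul _, ?_⟩
  have hi : ∫ X, macgStar Ω X ∂(stiefelUniform h) = Ω.det ^ (-((r : ℝ) / 2)) := by
    rw [stiefelUniform, integral_map (continuous_firstColumns h).measurable.aemeasurable
      (continuous_macgStar hΩ).aestronglyMeasurable,
      integral_eq_lintegral_of_nonneg_ae (.of_forall fun Q => macgStar_nonneg hΩ _)
      ((continuous_macgStar hΩ).comp (continuous_firstColumns h)).aestronglyMeasurable,
      lintegral_macgStar h hΩ, ENNReal.toReal_ofReal (Real.rpow_nonneg hd.le _)]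
  unfold macgDensity
  rw [integral_const_mul, hi, ← Real.rpow_add hd, add_neg_cancel, Real.rpow_zero]

/-! ### The envelope inequality. -/

theorem posDef_envelopeMatrix {q : ℕ} {A : Matrix (Fin q) (Fin q) ℝ} (hA : A.PosSemidef) {b : ℝ}
    (hb : 0 < b) : (envelopeMatrix A b).PosDef :=
  Matrix.PosDef.one.add_posSemidef (hA.smul (by positivity))

/-- With `t = (b + 2μ)/q` the powers of `q/b` cancel, leaving `q log t ≤ q(t - 1)`. -/
theorem exp_neg_le_rpow {q b μ : ℝ} (hq : 0 < q) (hb : 0 < b) (hμ : 0 ≤ μ) :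
    Real.exp (-μ) ≤ Real.exp (-(q - b) / 2) * (q / b) ^ (q / 2) *
      (1 + 2 / b * μ) ^ (-(q / 2)) := by
  have ht : 0 < (b + 2 * μ) / q := by positivity
  have hqb : 0 < q / b := by positivity
  have hlog := Real.log_le_sub_one_of_pos ht
  have e : 1 + 2 / b * μ = (q / b) * ((b + 2 * μ) / q) := by field_simp
  rw [e, Real.mul_rpow hqb.le ht.le, ← mul_assoc, mul_assoc (Real.exp _), ← Real.rpow_add hqb,
    add_neg_cancel, Real.rpow_zero, mul_one, Real.rpow_def_of_pos ht, ← Real.exp_add]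
  refine Real.exp_le_exp.mpr ?_
  have h2 : q * Real.log ((b + 2 * μ) / q) ≤ b + 2 * μ - q := by
    calc _ ≤ q * ((b + 2 * μ) / q - 1) := mul_le_mul_of_nonneg_left hlog hq.le
      _ = _ := by field_simp
  linarith

theorem mbStar_le_macgStar {r q : ℕ} {A : Matrix (Fin q) (Fin q) ℝ} (hA : A.PosSemidef)
    (hq : 0 < q) {b : ℝ} (hb : 0 < b) (X : stiefel r q) :
    mbStar A X ≤ (Real.exp (-((q : ℝ) - b) / 2) * ((q : ℝ) / b) ^ ((q : ℝ) / 2)) ^ r *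
      macgStar (envelopeMatrix A b) X := by
  have hW : (X.1ᵀ * A * X.1).PosSemidef := by simpa using hA.conjTranspose_mul_mul_same X.1
  have hΩ : X.1ᵀ * envelopeMatrix A b * X.1 = 1 + (2 / b) • (X.1ᵀ * A * X.1) := by
    simp only [envelopeMatrix, Matrix.mul_add, Matrix.add_mul, Matrix.mul_one, Matrix.mul_smul,
      Matrix.smul_mul, show X.1ᵀ * X.1 = 1 from X.2]
  have hμ := hW.eigenvalues_nonneg
  unfold mbStar macgStar
  rw [hΩ, hW.1.det_one_add_smul, hW.1.trace_eq_sum_eigenvalues,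
    ← Real.finsetProd_rpow _ _ (fun i _ => by have := hμ i; positivity), ← Finset.sum_neg_distrib,
    Real.exp_sum]
  rw [show ∀ K : ℝ, K ^ r = ∏ _i : Fin r, K by simp, ← Finset.prod_mul_distrib]
  exact Finset.prod_le_prod (fun _ _ => Real.exp_nonneg _) fun i _ =>
    exp_neg_le_rpow (by exact_mod_cast hq) hb (hμ i)

theorem mbDensity_le_macgDensity {r q : ℕ} (h : r ≤ q) {A : Matrix (Fin q) (Fin q) ℝ}
    (hA : A.PosSemidef) (hq : 0 < q) {b : ℝ} (hb : 0 < b) (X : stiefel r q) :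
    mbDensity h A X ≤ envelopeBound h A b * macgDensity (envelopeMatrix A b) X := by
  have hd := (posDef_envelopeMatrix hA hb).det_pos
  have hpow : ((envelopeMatrix A b).det ^ (-(1 / 2 : ℝ))) ^ r *
      (envelopeMatrix A b).det ^ ((r : ℝ) / 2) = 1 := by
    rw [← Real.rpow_natCast, ← Real.rpow_mul hd.le, ← Real.rpow_add hd]
    convert Real.rpow_zero _ using 2
    ring
  calc mbDensity h A X ≤ mbConst h A *
        ((Real.exp (-((q : ℝ) - b) / 2) * ((q : ℝ) / b) ^ ((q : ℝ) / 2)) ^ r *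
          macgStar (envelopeMatrix A b) X) :=
        mul_le_mul_of_nonneg_left (mbStar_le_macgStar hA hq hb X) (mbConst_pos h A).le
    _ = _ := by
        unfold envelopeBound macgDensity
        rw [mul_pow _ (_ ^ (-(1 / 2 : ℝ)))]
        linear_combination (-mbConst h A *
          ((Real.exp (-((q : ℝ) - b) / 2) * ((q : ℝ) / b) ^ ((q : ℝ) / 2)) ^ r *
          macgStar (envelopeMatrix A b) X)) * hpow

/-! ### Minimizing the bound over `b`. -/

/-- The exponential form of the base of the envelope bound. -/
theorem envelope_base_eq_exp {q : ℕ} {A : Matrix (Fin q) (Fin q) ℝ} (hA : A.IsHermitian)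
    (hlam : ∀ i, 0 ≤ hA.eigenvalues i) (hq : 0 < q) {b : ℝ} (hb : 0 < b) :
    Real.exp (-((q : ℝ) - b) / 2) * ((q : ℝ) / b) ^ ((q : ℝ) / 2) *
      (envelopeMatrix A b).det ^ (-(1 / 2 : ℝ)) =
    Real.exp (((q : ℝ) * Real.log q - q + (b - ∑ i, Real.log (b + 2 * hA.eigenvalues i))) / 2) := by
  have hq' : (0 : ℝ) < q := by exact_mod_cast hq
  have hpos : ∀ i, 0 < 1 + 2 / b * hA.eigenvalues i := fun i => by
    have := hlam i; positivity
  have hlog : ∀ i, Real.log (1 + 2 / b * hA.eigenvalues i) =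
      Real.log (b + 2 * hA.eigenvalues i) - Real.log b := fun i => by
    have := hlam i
    rw [← Real.log_div (by positivity) hb.ne']
    congr 1
    field_simp
  rw [envelopeMatrix, hA.det_one_add_smul, Real.rpow_def_of_pos (by positivity),
    Real.rpow_def_of_pos (Finset.prod_pos fun i _ => hpos i), ← Real.exp_add, ← Real.exp_add,
    Real.log_prod (fun i _ => (hpos i).ne'), Real.log_div hq'.ne' hb.ne']
  simp only [hlog, Finset.sum_sub_distrib, Finset.sum_const, Finset.card_univ, Fintype.card_fin,
    nsmul_eq_mul]
  congr 1
  ring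

/-- Each logarithm lies strictly below its tangent at `b₀`; by `hsum` the tangent slopes add up to
1, so no derivative test is needed. -/
theorem sub_sum_log_lt {q : ℕ} {l : Fin q → ℝ} (hl : ∀ i, 0 ≤ l i) {b₀ b : ℝ} (hb₀ : 0 < b₀)
    (hb : 0 < b) (hne : b ≠ b₀) (hq : 0 < q) (hsum : ∑ i, 1 / (b₀ + 2 * l i) = 1) :
    b₀ - ∑ i, Real.log (b₀ + 2 * l i) < b - ∑ i, Real.log (b + 2 * l i) := by
  have : Nonempty (Fin q) := ⟨⟨0, hq⟩⟩
  have key : ∑ i, (Real.log (b + 2 * l i) - Real.log (b₀ + 2 * l i)) <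
      ∑ i, (b - b₀) * (1 / (b₀ + 2 * l i)) := by
    refine Finset.sum_lt_sum_of_nonempty Finset.univ_nonempty fun i _ => ?_
    have h0 : 0 < b₀ + 2 * l i := by have := hl i; positivity
    have h1 : 0 < b + 2 * l i := by have := hl i; positivity
    rw [← Real.log_div h1.ne' h0.ne']
    have hne' : (b + 2 * l i) / (b₀ + 2 * l i) ≠ 1 := by
      rw [Ne, div_eq_one_iff_eq h0.ne']
      exact fun h => hne (add_right_cancel h)
    refine (Real.log_lt_sub_one_of_pos (div_pos h1 h0) hne').trans_eq ?_
    field_simp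
    ring
  rw [← Finset.mul_sum, hsum, Finset.sum_sub_distrib] at key
  linarith

theorem strictAntiOn_sum_inv {q : ℕ} {l : Fin q → ℝ} (hl : ∀ i, 0 ≤ l i) (hq : 0 < q) :
    StrictAntiOn (fun b : ℝ => ∑ i, 1 / (b + 2 * l i)) (Set.Ioi 0) := by
  intro x hx y _ hxy
  have : Nonempty (Fin q) := ⟨⟨0, hq⟩⟩
  have hx' : 0 < x := hx
  refine Finset.sum_lt_sum_of_nonempty Finset.univ_nonempty fun i _ => ?_
  have := hl i
  exact one_div_lt_one_div_of_lt (by positivity) (by linarith)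

/-- The secular equation `∑ 1 / (b + 2 lᵢ) = 1` has a root in `[1, q]`. -/
theorem exists_sum_inv_eq_one {q : ℕ} {l : Fin q → ℝ} (hl : ∀ i, 0 ≤ l i) {i₀ : Fin q}
    (hi₀ : l i₀ = 0) : ∃ b₀ ∈ Set.Icc (1 : ℝ) q, ∑ i, 1 / (b₀ + 2 * l i) = 1 := by
  have hq : 0 < q := i₀.pos
  have hq' : (1 : ℝ) ≤ q := by exact_mod_cast hq
  have hcont : ContinuousOn (fun b : ℝ => ∑ i, 1 / (b + 2 * l i)) (Set.Icc 1 q) := by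
    refine continuousOn_finsetSum _ fun i _ => ?_
    refine ContinuousOn.div (by fun_prop) (by fun_prop) fun b hb => ?_
    have := hl i
    have := hb.1
    positivity
  refine intermediate_value_Icc' hq' hcont ⟨?_, ?_⟩
  · calc ∑ i, 1 / ((q : ℝ) + 2 * l i) ≤ ∑ _i : Fin q, 1 / (q : ℝ) := by
          refine Finset.sum_le_sum fun i _ => ?_
          have := hl i
          exact one_div_le_one_div_of_le (by linarith) (by linarith)
      _ = 1 := by
          simp [hq.ne']
  -- At `b = 1` the zero value `l i₀` alone contributes 1.
  · have h := Finset.single_le_sum (f := fun i => 1 / ((1 : ℝ) + 2 * l i))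
      (fun i _ => by have := hl i; positivity) (Finset.mem_univ i₀)
    simpa [hi₀] using h

theorem sum_inv_card_lt_one {q : ℕ} {l : Fin q → ℝ} (hl : ∀ i, 0 ≤ l i) {i₁ : Fin q}
    (hi₁ : 0 < l i₁) : ∑ i, 1 / ((q : ℝ) + 2 * l i) < 1 := by
  have hq : 0 < q := i₁.pos
  have hq' : (0 : ℝ) < q := by exact_mod_cast hq
  calc ∑ i, 1 / ((q : ℝ) + 2 * l i) < ∑ _i : Fin q, 1 / (q : ℝ) := by
        refine Finset.sum_lt_sum (fun i _ => ?_) ⟨i₁, Finset.mem_univ _, ?_⟩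
        · have := hl i
          exact one_div_le_one_div_of_le hq' (by linarith)
        · exact one_div_lt_one_div_of_lt hq' (by linarith)
    _ = 1 := by simp [hq.ne']

theorem mainTheorem3 {r q : ℕ} (hr : 1 ≤ r) (hrq : r ≤ q)
    (A : Matrix (Fin q) (Fin q) ℝ) (hA : A.IsHermitian)
    (hmin : IsLeast (Set.range hA.eigenvalues) 0) :
    IsProbDensity (stiefelUniform hrq) (mbDensity hrq A) ∧
    (∀ b : ℝ, 0 < b →
      (envelopeMatrix A b).PosDef ∧
      IsProbDensity (stiefelUniform hrq) (macgDensity (envelopeMatrix A b)) ∧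
      (∀ X : stiefel r q,
        mbStar A X ≤
          (Real.exp (-((q : ℝ) - b) / 2) * ((q : ℝ) / b) ^ ((q : ℝ) / 2)) ^ r *
            macgStar (envelopeMatrix A b) X) ∧
      (∀ X : stiefel r q,
        mbDensity hrq A X ≤ envelopeBound hrq A b * macgDensity (envelopeMatrix A b) X)) ∧
    (∃ b₀ : ℝ, 0 < b₀ ∧ b₀ ≤ q ∧ (A ≠ 0 → b₀ < q) ∧
      (∀ b : ℝ, 0 < b → (∑ i, 1 / (b + 2 * hA.eigenvalues i) = 1 ↔ b = b₀)) ∧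
      (∀ b : ℝ, 0 < b → b ≠ b₀ → envelopeBound hrq A b₀ < envelopeBound hrq A b)) := by
  obtain ⟨⟨i₀, hi₀⟩, hlow⟩ := hmin
  have hlam : ∀ i, 0 ≤ hA.eigenvalues i := fun i => hlow ⟨i, rfl⟩
  have hps : A.PosSemidef := hA.posSemidef_iff_eigenvalues_nonneg.mpr hlam
  have hq : 0 < q := i₀.pos
  refine ⟨isProbDensity_mbDensity hrq A, fun b hb => ⟨posDef_envelopeMatrix hps hb,
    isProbDensity_macgDensity hrq (posDef_envelopeMatrix hps hb),
    mbStar_le_macgStar hps hq hb, mbDensity_le_macgDensity hrq hps hq hb⟩, ?_⟩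
  obtain ⟨b₀, ⟨h1, hle⟩, hsum⟩ := exists_sum_inv_eq_one hlam hi₀
  have hb₀ : 0 < b₀ := one_pos.trans_le h1
  refine ⟨b₀, hb₀, hle, fun hA0 => ?_, fun b hb => ⟨fun h => ?_, fun h => h ▸ hsum⟩,
    fun b hb hne => ?_⟩
  · refine lt_of_le_of_ne hle fun heq => ?_
    have hne : hA.eigenvalues ≠ 0 := fun h => hA0 (hA.eigenvalues_eq_zero_iff.mp h)
    obtain ⟨i₁, hi₁⟩ := Function.ne_iff.mp hne
    have := sum_inv_card_lt_one hlam (lt_of_le_of_ne (hlam i₁) (Ne.symm hi₁))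
    rw [← heq, hsum] at this
    exact lt_irrefl _ this
  · exact (strictAntiOn_sum_inv hlam hq).injOn hb hb₀ (h.trans hsum.symm)
  · unfold envelopeBound
    rw [envelope_base_eq_exp hA hlam hq hb₀, envelope_base_eq_exp hA hlam hq hb]
    -- Strictness survives the `r`-th power because `r ≥ 1`.
    refine mul_lt_mul_of_pos_left (pow_lt_pow_left₀ (Real.exp_lt_exp.mpr ?_)
      (Real.exp_nonneg _) (Nat.one_le_iff_ne_zero.mp hr)) (mbConst_pos hrq A)
    linarith [sub_sum_log_lt hlam hb₀ hb hne hq hsum]
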